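/- Semigroups are nonempty. A *pseudovariety of semigroups* is a class of finite semigroups closed under taking subsemigroups, homomorphic images and finite direct products (including the empty product). A semigroup $S$ is *equidivisible* if, for all $u,v,x,y\in S$, the equality $uv=xy$ implies that $u=x$ and $v=y$, or that there is $t\in S$ with $ut=x$ and $v=ty$, or that there is $t\in S$ with $xt=u$ and $y=tv$. For a pseudovariety $\mathsf V$ and a finite nonempty alphabet $A$, the free pro-$\mathsf V$ semigroup over $A$ is the inverse limit of the quotients of the free semigroup $A^+$ that belong to $\mathsf V$; the pseudovariety $\mathsf V$ is *equidivisible* if the free pro-$\mathsf V$ semigroup over every finite nonempty alphabet is equidivisible. Let $\mathsf{CS}$ be the pseudovariety of finite completely simple semigroups. For a semigroup $S$, let $S^I$ be $S$ with a new identity $I$ adjoined. Let $\varphi\colon A^+\to S$ be an onto homomorphism, extended to $A^*\to S^I$ by mapping the empty word to $I$. The two-sided Cayley graph $\Gamma_\varphi$ is the directed graph with vertex set $S^I\times S^I$ whose edges are the triples $((s_1,t_1),a,(s_2,t_2))$ with $a\in A$, $s_1\varphi(a)=s_2$ and $t_1=\varphi(a)t_2$. For $u\in A^+$, let $p_u$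 be the unique path labeled $u$ from $(I,\varphi(u))$ to $(\varphi(u),I)$, and let $T(p_u)$ be the set of its transition edges, that is, of those edges of $p_u$ whose source and target lie in different strongly connected components of $\Gamma_\varphi$. The *two-sided Karnofsky–Rhodes expansion* of $S$ with respect to $\varphi$ is $S_\varphi^{K(\ell 1)}=A^+/{\equiv_\varphi}$, where $\equiv_\varphi$ is the congruence such that $u\equiv_\varphi v$ if and only if $\varphi(u)=\varphi(v)$ and $T(p_u)=T(p_v)$. A pseudovariety $\mathsf V$ is *closed under the two-sided Karnofsky–Rhodes expansion* if $S_\varphi^{K(\ell 1)}\in\mathsf V$ whenever $S\in\mathsf V$ and $\varphi$ is a homomorphism from a finitely generated free semigroup onto $S$. **Theorem.** A pseudovariety of semigroups $\mathsf V$ is equidivisible if and only if $\mathsf V$ is contained in $\mathsf{CS}$ or $\mathsf V$ is closed under the two-sided Karnofsky–Rhodes expansion. -/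

import Mathlib

universe u

/-- A semigroup `S` is equidivisible if `u * v = x * y` implies that the two factorizations
coincide, or that one of them refines the other through some `t`. -/
def IsEquidivisible (S : Type u) [Semigroup S] : Prop :=
  ∀ u v x y : S, u * v = x * y →
    (u = x ∧ v = y) ∨ (∃ t : S, u * t = x ∧ v = t * y) ∨ (∃ t : S, x * t = u ∧ y = t * v)

/-- A completely simple semigroup: a nonempty semigroup without proper (two-sided, nonempty)
ideals that has a primitive idempotent, i.e. a minimal one in the natural order of idempotents. -/
def IsCompletelySimple (S : Type u) [Semigroup S] : Prop :=
  (∀ J : Set S, J.Nonempty → (∀ s : S, ∀ x ∈ J, s * x ∈ J ∧ x * s ∈ J) → J = Set.univ) ∧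
  ∃ e : S, e * e = e ∧ ∀ f : S, f * f = f → e * f = f → f * e = f → f = e

/-- A pseudovariety of semigroups: a class of finite (nonempty) semigroups closed under
subsemigroups, homomorphic images and finite direct products (including the empty one). -/
structure SemigroupPseudovariety where
  /-- membership in the class -/
  Mem : (S : Type u) → [Semigroup S] → Prop
  finite_of_mem : ∀ (S : Type u) [Semigroup S], Mem S → Finite S
  nonempty_of_mem : ∀ (S : Type u) [Semigroup S], Mem S → Nonempty S
  mem_trivial : Mem PUnit.{u + 1}
  mem_prod : ∀ (S T : Type u) [Semigroup S] [Semigroup T], Mem S → Mem T → Mem (S × T)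
  mem_subsemigroup : ∀ (S : Type u) [Semigroup S], Mem S →
    ∀ T : Subsemigroup S, (T : Set S).Nonempty → Mem T
  mem_image : ∀ (S T : Type u) [Semigroup S] [Semigroup T] (f : S →ₙ* T),
    Function.Surjective f → Mem S → Mem T

namespace SemigroupPseudovariety

/-- The index set of the inverse system of the `A`-generated members of `V`: the congruences
on the free semigroup `A⁺` whose quotient belongs to `V`. -/
def FreeIndex (V : SemigroupPseudovariety.{u}) (A : Type u) : Type u :=
  {c : Con (FreeSemigroup A) // V.Mem c.Quotient}

/-- The canonical projection `A⁺/c → A⁺/d` for congruences `c ≤ d`. -/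
def conProj {A : Type u} {c d : Con (FreeSemigroup A)} (h : c ≤ d) : c.Quotient →ₙ* d.Quotient where
  toFun := Quotient.map' id fun _ _ hxy => h hxy
  map_mul' := by
    rintro ⟨x⟩ ⟨y⟩
    rfl

/-- The free pro-`V` semigroup over a (nonempty) alphabet `A`: the inverse limit of the
`A`-generated members of `V`, i.e. the compatible families in the product of the
quotients `A⁺/c` lying in `V`. -/
def freePro (V : SemigroupPseudovariety.{u}) (A : Type u) :
    Subsemigroup (∀ c : V.FreeIndex A, c.1.Quotient) where
  carrier := {x | ∀ (c d : V.FreeIndex A) (h : c.1 ≤ d.1), conProj h (x c) = x d}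
  mul_mem' := by
    intro x y hx hy c d h
    simp only [Pi.mul_apply, map_mul, hx c d h, hy c d h]

/-- `V` is equidivisible if all finitely generated free pro-`V` semigroups are. -/
def Equidivisible (V : SemigroupPseudovariety.{u}) : Prop :=
  ∀ (A : Type u) [Finite A] [Nonempty A], IsEquidivisible (V.freePro A)

/-- `V` is contained in the pseudovariety `CS` of finite completely simple semigroups. -/
def ContainedInCS (V : SemigroupPseudovariety.{u}) : Prop :=
  ∀ (S : Type u) [Semigroup S], V.Mem S → IsCompletelySimple S

end SemigroupPseudovariety

namespace KarnofskyRhodes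

variable {A S : Type u} [Semigroup S]

/-- Vertices of the two-sided Cayley graph: pairs of elements of `S^I`, where `S^I = WithOne S`
is `S` with a new identity adjoined (even if `S` has one already). -/
abbrev Vertex (S : Type u) : Type u := WithOne S × WithOne S

/-- Triples (source, letter, target). -/
abbrev Triple (A S : Type u) : Type u := Vertex S × A × Vertex S

/-- The value in `S^I` of a possibly empty word. -/
def val (φ : FreeSemigroup A →ₙ* S) (w : List A) : WithOne S :=
  (w.map fun a => (φ (FreeSemigroup.of a) : WithOne S)).prod

/-- `((s₁, t₁), a, (s₂, t₂))` is an edge of the two-sided Cayley graph of `φ` if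
`s₁ φ(a) = s₂` and `t₁ = φ(a) t₂`. -/
def IsEdge (φ : FreeSemigroup A →ₙ* S) (e : Triple A S) : Prop :=
  e.1.1 * (φ (FreeSemigroup.of e.2.1) : WithOne S) = e.2.2.1 ∧
  e.1.2 = (φ (FreeSemigroup.of e.2.1) : WithOne S) * e.2.2.2

/-- There is a (possibly empty) directed path from `p` to `q`. -/
def Reachable (φ : FreeSemigroup A →ₙ* S) (p q : Vertex S) : Prop :=
  Relation.ReflTransGen (fun x y => ∃ a : A, IsEdge φ (x, a, y)) p q

/-- A transition edge: its ends lie in different strongly connected components. -/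
def IsTransitionEdge (φ : FreeSemigroup A →ₙ* S) (e : Triple A S) : Prop :=
  IsEdge φ e ∧ ¬ (Reachable φ e.1 e.2.2 ∧ Reachable φ e.2.2 e.1)

/-- The underlying list of letters of a nonempty word. -/
def letters (w : FreeSemigroup A) : List A := w.head :: w.tail

/-- The edges of the path `p_w` labeled `w` from `(I, φ(w))` to `(φ(w), I)`: for each factorization
`w = w₁ a w₂` with `a` a letter, the edge from `(φ(w₁), φ(a w₂))` to `(φ(w₁ a), φ(w₂))`. -/
def pathEdges (φ : FreeSemigroup A →ₙ* S) (w : FreeSemigroup A) : Set (Triple A S) :=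
  {e | ∃ (w₁ : List A) (a : A) (w₂ : List A), letters w = w₁ ++ a :: w₂ ∧
    e = ((val φ w₁, val φ (a :: w₂)), a, (val φ (w₁ ++ [a]), val φ w₂))}

/-- The set `T(p_w)` of transition edges in the path `p_w`. -/
def transitionEdges (φ : FreeSemigroup A →ₙ* S) (w : FreeSemigroup A) : Set (Triple A S) :=
  {e | e ∈ pathEdges φ w ∧ IsTransitionEdge φ e}

theorem val_append (φ : FreeSemigroup A →ₙ* S) (v w : List A) :
    val φ (v ++ w) = val φ v * val φ w := by
  simp [val]

theorem letters_mul (v w : FreeSemigroup A) : letters (v * w) = letters v ++ letters w := by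
  simp [letters]

theorem val_letters (φ : FreeSemigroup A →ₙ* S) (w : FreeSemigroup A) :
    val φ (letters w) = (φ w : WithOne S) := by
  induction w using FreeSemigroup.recOnMul with
  | ih1 a => simp [val, letters, FreeSemigroup.of]
  | ih2 a w h₁ h₂ => rw [letters_mul, val_append, h₁, h₂, map_mul, WithOne.coe_mul]

/-- Multiplying the first coordinates on the left by `l` and the second ones on the right by `r`. -/
def shift (l r : WithOne S) (p : Vertex S) : Vertex S := (l * p.1, p.2 * r)

theorem IsEdge.shift {φ : FreeSemigroup A →ₙ* S} {p q : Vertex S} {a : A}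
    (h : IsEdge φ (p, a, q)) (l r : WithOne S) :
    IsEdge φ (KarnofskyRhodes.shift l r p, a, KarnofskyRhodes.shift l r q) := by
  obtain ⟨h₁, h₂⟩ := h
  simp only at h₁ h₂
  constructor <;> simp [KarnofskyRhodes.shift, ← h₁, h₂, mul_assoc]

theorem Reachable.shift {φ : FreeSemigroup A →ₙ* S} {p q : Vertex S}
    (h : Reachable φ p q) (l r : WithOne S) :
    Reachable φ (KarnofskyRhodes.shift l r p) (KarnofskyRhodes.shift l r q) :=
  Relation.ReflTransGen.lift (p := fun x y => ∃ a : A, IsEdge φ (x, a, y))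
    (fun v => KarnofskyRhodes.shift l r v) (fun _ _ ha => ⟨ha.choose, ha.choose_spec.shift l r⟩) _ _ h

theorem isEdge_of_mem_pathEdges {φ : FreeSemigroup A →ₙ* S} {w : FreeSemigroup A}
    {e : Triple A S} (h : e ∈ pathEdges φ w) : IsEdge φ e := by
  obtain ⟨w₁, a, w₂, -, rfl⟩ := h
  constructor <;> simp [val]

theorem mem_pathEdges_mul (φ : FreeSemigroup A →ₙ* S) (v w : FreeSemigroup A) (e : Triple A S) :
    e ∈ pathEdges φ (v * w) ↔
      (∃ d ∈ pathEdges φ v, e = (shift 1 (φ w) d.1, d.2.1, shift 1 (φ w) d.2.2)) ∨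
      (∃ d ∈ pathEdges φ w, e = (shift (φ v) 1 d.1, d.2.1, shift (φ v) 1 d.2.2)) := by
  constructor
  · rintro ⟨w₁, a, w₂, hw, rfl⟩
    rw [letters_mul, List.append_eq_append_iff] at hw
    rcases hw with ⟨m, rfl, hm⟩ | ⟨m, hv, hm⟩
    · refine Or.inr ⟨_, ⟨m, a, w₂, hm, rfl⟩, ?_⟩
      simp [shift, val_append, val_letters]
    · rcases m with _ | ⟨b, m⟩
      · refine Or.inr ⟨_, ⟨[], a, w₂, by simpa using hm.symm, rfl⟩, ?_⟩
        have h : val φ w₁ = (φ v : WithOne S) := by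
          rw [← val_letters, hv, List.append_nil]
        rw [val_append, h]
        simp [shift, val]
      · simp only [List.cons_append, List.cons.injEq] at hm
        obtain ⟨rfl, rfl⟩ := hm
        refine Or.inl ⟨_, ⟨w₁, a, m, hv, rfl⟩, ?_⟩
        have h : val φ (a :: (m ++ letters w)) = val φ (a :: m) * (φ w : WithOne S) := by
          rw [← val_letters, ← val_append, List.cons_append]
        simp [shift, h, val_append, val_letters]
  · rintro (⟨_, ⟨w₁, a, w₂, hw, rfl⟩, rfl⟩ | ⟨_, ⟨w₁, a, w₂, hw, rfl⟩, rfl⟩)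
    · refine ⟨w₁, a, w₂ ++ letters w, by rw [letters_mul, hw]; simp, ?_⟩
      have h : val φ (a :: (w₂ ++ letters w)) = val φ (a :: w₂) * (φ w : WithOne S) := by
        rw [← val_letters, ← val_append, List.cons_append]
      simp [shift, h, val_append, val_letters]
    · refine ⟨letters v ++ w₁, a, w₂, by rw [letters_mul, hw]; simp, ?_⟩
      simp [shift, val_append, val_letters]

theorem isTransitionEdge_of_shift {φ : FreeSemigroup A →ₙ* S} {d : Triple A S} {l r : WithOne S}
    (hd : IsEdge φ d) (h : IsTransitionEdge φ (shift l r d.1, d.2.1, shift l r d.2.2)) :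
    IsTransitionEdge φ d :=
  ⟨hd, fun hr => h.2 ⟨hr.1.shift l r, hr.2.shift l r⟩⟩

theorem transitionEdges_mul_subset {φ : FreeSemigroup A →ₙ* S} {v v' w w' : FreeSemigroup A}
    (hv : φ v = φ v') (hw : φ w = φ w') (hv' : transitionEdges φ v ⊆ transitionEdges φ v')
    (hw' : transitionEdges φ w ⊆ transitionEdges φ w') :
    transitionEdges φ (v * w) ⊆ transitionEdges φ (v' * w') := by
  rintro e ⟨he, ht⟩
  refine ⟨?_, ht⟩
  rw [mem_pathEdges_mul] at he ⊢
  rw [← hv, ← hw]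
  rcases he with ⟨d, hd, rfl⟩ | ⟨d, hd, rfl⟩
  · exact Or.inl ⟨d, (hv' ⟨hd, isTransitionEdge_of_shift (isEdge_of_mem_pathEdges hd) ht⟩).1, rfl⟩
  · exact Or.inr ⟨d, (hw' ⟨hd, isTransitionEdge_of_shift (isEdge_of_mem_pathEdges hd) ht⟩).1, rfl⟩

/-- The congruence `≡_φ` on `A⁺`: `v ≡ w` iff `φ(v) = φ(w)` and `T(p_v) = T(p_w)`. -/
def congruence (φ : FreeSemigroup A →ₙ* S) : Con (FreeSemigroup A) where
  r v w := φ v = φ w ∧ transitionEdges φ v = transitionEdges φ w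
  iseqv :=
    ⟨fun _ => ⟨rfl, rfl⟩, fun h => ⟨h.1.symm, h.2.symm⟩,
      fun h h' => ⟨h.1.trans h'.1, h.2.trans h'.2⟩⟩
  mul' := by
    rintro v v' w w' ⟨hv, hv'⟩ ⟨hw, hw'⟩
    refine ⟨by rw [map_mul, map_mul, hv, hw], Set.Subset.antisymm ?_ ?_⟩
    · exact transitionEdges_mul_subset hv hw hv'.subset hw'.subset
    · exact transitionEdges_mul_subset hv.symm hw.symm hv'.symm.subset hw'.symm.subset

/-- The two-sided Karnofsky-Rhodes expansion of `S` with respect to `φ : A⁺ → S`. -/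
abbrev Expansion (φ : FreeSemigroup A →ₙ* S) : Type u := (congruence φ).Quotient

end KarnofskyRhodes

/-- `V` is closed under the two-sided Karnofsky-Rhodes expansion: the expansion of every `S` in `V`
with respect to every homomorphism from a finitely generated free semigroup onto `S` is in `V`. -/
def SemigroupPseudovariety.ClosedUnderKR (V : SemigroupPseudovariety.{u}) : Prop :=
  ∀ (A S : Type u) [Finite A] [Semigroup S] (φ : FreeSemigroup A →ₙ* S),
    Function.Surjective φ → V.Mem S → V.Mem (KarnofskyRhodes.Expansion φ)
/-!
A factorization of an element can be regarded as a cut `(s, t)` in `S^I × S^I`, that is, as a vertex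
of the two-sided Cayley graph, and reachability in this graph says that `t` begins with a factor
that can be moved to the end of `s`. A semigroup is equidivisible exactly if any two cuts of the
same element are comparable for this relation, and by compactness it is enough for a free pro-`V`
semigroup that its cuts become comparable in every finite quotient.

* In a finite simple semigroup, all cuts of an element are comparable.
* If `w ≡_φ w'`, every vertex of `p_w` is strongly connected to the origin of `p_w` or to the target
  of a transition edge, both of which also lie on `p_w'`, so the vertices of the two paths are
  comparable. Hence closure under the expansion implies equidivisibility.
* Conversely, if `φ(w) = φ(w')` but `T(p_w) ⊄ T(p_w')`, then some edges of `p_w` and `p_w'` are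
  different and neither one precedes the other. If the expansion of `S` is not in `V`, such pairs
  exist modulo every finite quotient and accumulate to one in the free pro-`V` semigroup.
  Equidivisibility forbids this when letters are indecomposable there, that is, when `V` contains a
  semigroup with an element that is not a product.
* If there is no such semigroup, all members of `V` are completely regular, so that `ab = (ab)²z` in
  the free pro-`V` semigroup on `a`, `b`. Equidivisibility makes the cuts `(a, b)` and `(ab, abz)`
  comparable, so that `b` is a factor of `a` or `a` one of `b`, which rules out members of `V` with
  a zero and another element.
-/

open KarnofskyRhodes Filter

section Cuts

/-- The order of the cuts of an element of `M` into two factors: the cut `p = (p₁, p₂)` of `p₁ p₂`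
comes before `q = (q₁, q₂)` if `q` arises from `p` by moving a factor `t` of `p₂` to `p₁`. -/
def CutsBefore {M : Type*} [Mul M] (p q : M × M) : Prop :=
  ∃ t : M, p.1 * t = q.1 ∧ p.2 = t * q.2

variable {M N : Type*}

theorem CutsBefore.refl [MulOneClass M] (p : M × M) : CutsBefore p p :=
  ⟨1, mul_one _, (one_mul _).symm⟩

theorem CutsBefore.trans [Semigroup M] {p q r : M × M} (hpq : CutsBefore p q)
    (hqr : CutsBefore q r) : CutsBefore p r := by
  obtain ⟨s, hs₁, hs₂⟩ := hpq
  obtain ⟨t, ht₁, ht₂⟩ := hqr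
  exact ⟨s * t, by rw [← mul_assoc, hs₁, ht₁], by rw [hs₂, ht₂, mul_assoc]⟩

theorem CutsBefore.map [Mul M] [Mul N] {F : Type*} [FunLike F M N] [MulHomClass F M N] (f : F)
    {p q : M × M} (h : CutsBefore p q) : CutsBefore (Prod.map f f p) (Prod.map f f q) := by
  obtain ⟨t, h₁, h₂⟩ := h
  exact ⟨f t, by simp only [Prod.map_fst, ← h₁, map_mul], by simp only [Prod.map_snd, h₂, map_mul]⟩

variable {S : Type*} [Semigroup S]

theorem IsEquidivisible.cutsBefore_or_cutsBefore (hS : IsEquidivisible S)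
    {p q : WithOne S × WithOne S} (h : p.1 * p.2 = q.1 * q.2) :
    CutsBefore p q ∨ CutsBefore q p := by
  obtain ⟨u, v⟩ := p
  obtain ⟨x, y⟩ := q
  dsimp only at h
  induction u with
  | one => exact Or.inl ⟨x, one_mul x, by rwa [one_mul] at h⟩
  | coe u =>
  induction x with
  | one => exact Or.inr ⟨u, one_mul _, by rwa [one_mul, eq_comm] at h⟩
  | coe x =>
  induction v with
  | one => exact Or.inr ⟨y, by rwa [mul_one, eq_comm] at h, (mul_one y).symm⟩
  | coe v =>
  induction y with
  | one => exact Or.inl ⟨v, by rwa [mul_one] at h, (mul_one _).symm⟩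
  | coe y =>
  rw [← WithOne.coe_mul, ← WithOne.coe_mul, WithOne.coe_inj] at h
  rcases hS u v x y h with ⟨rfl, rfl⟩ | ⟨t, rfl, rfl⟩ | ⟨t, rfl, rfl⟩
  · exact Or.inl (CutsBefore.refl _)
  · exact Or.inl ⟨t, rfl, rfl⟩
  · exact Or.inr ⟨t, rfl, rfl⟩

theorem CutsBefore.eq_or_exists_of_coe {u v x y : S}
    (h : CutsBefore ((u : WithOne S), (v : WithOne S)) (x, y)) :
    (u = x ∧ v = y) ∨ ∃ t : S, u * t = x ∧ v = t * y := by
  obtain ⟨t, h₁, h₂⟩ := h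
  induction t with
  | one => exact Or.inl ⟨by simpa using h₁, by simpa using h₂⟩
  | coe t => exact Or.inr ⟨t, WithOne.coe_inj.1 h₁, WithOne.coe_inj.1 h₂⟩

theorem isEquidivisible_of_cutsBefore_or_cutsBefore
    (h : ∀ u v x y : S, u * v = x * y →
      CutsBefore ((u : WithOne S), (v : WithOne S)) (x, y) ∨
        CutsBefore ((x : WithOne S), (y : WithOne S)) (u, v)) : IsEquidivisible S := by
  intro u v x y huv
  rcases h u v x y huv with h | h
  · exact h.eq_or_exists_of_coe.imp_right Or.inl
  · exact h.eq_or_exists_of_coe.imp (fun h => ⟨h.1.symm, h.2.symm⟩) Or.inr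

end Cuts

instance {S : Type*} [Finite S] : Finite (WithOne S) :=
  inferInstanceAs (Finite (Option S))

section FiniteSimple

theorem exists_mul_pow_succ_eq_of_mul_mul_eq {M : Type*} [Monoid M] [Finite M] {a b x : M}
    (h : a * x * b = x) : ∃ n : ℕ, x * b ^ (n + 1) = x := by
  have hpow : ∀ n : ℕ, a ^ n * x * b ^ n = x := by
    intro n
    induction n with
    | zero => simp
    | succ n ih =>
      calc a ^ (n + 1) * x * b ^ (n + 1) = a ^ n * (a * x * b) * b ^ n := by
            rw [pow_succ, pow_succ']; simp only [mul_assoc]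
        _ = x := by rw [h, ih]
  obtain ⟨m, -, n, -, hmn, hb⟩ := Set.infinite_univ.exists_lt_map_eq_of_mapsTo
    (Set.mapsTo_univ (fun n : ℕ => b ^ n) Set.univ) Set.finite_univ
  obtain ⟨k, rfl⟩ := Nat.exists_eq_add_of_lt hmn
  refine ⟨k, ?_⟩
  calc x * b ^ (k + 1) = a ^ m * x * (b ^ m * b ^ (k + 1)) := by
        rw [← mul_assoc (a ^ m * x), hpow]
    _ = x := by rw [← pow_add, ← add_assoc, ← hb, hpow]

theorem exists_pow_succ_mul_eq_of_mul_mul_eq {M : Type*} [Monoid M] [Finite M] {a b x : M}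
    (h : a * x * b = x) : ∃ n : ℕ, a ^ (n + 1) * x = x := by
  have : Finite Mᵐᵒᵖ := Finite.of_equiv M MulOpposite.opEquiv
  have hop : MulOpposite.op b * MulOpposite.op x * MulOpposite.op a = MulOpposite.op x := by
    rw [← MulOpposite.op_mul, ← MulOpposite.op_mul, ← mul_assoc, h]
  obtain ⟨n, hn⟩ := exists_mul_pow_succ_eq_of_mul_mul_eq hop
  exact ⟨n, MulOpposite.op_injective (by simpa only [MulOpposite.op_mul, MulOpposite.op_pow])⟩

namespace IsCompletelySimple

variable {S : Type*} [Semigroup S]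

theorem exists_mul_mul_eq (hS : IsCompletelySimple S) (p x : S) : ∃ a b, a * p * b = x := by
  have huniv := hS.1 {z | ∃ a b, a * p * b = z} ⟨p * p * p, p, p, rfl⟩ (by
    rintro s _ ⟨a, b, rfl⟩
    exact ⟨⟨s * a, b, by simp only [mul_assoc]⟩, ⟨a, b * s, by simp only [mul_assoc]⟩⟩)
  exact Set.eq_univ_iff_forall.1 huniv x

theorem exists_mul_mul_eq_left [Finite S] (hS : IsCompletelySimple S) (x y : S) :
    ∃ r : WithOne S, x * y * r = x := by
  obtain ⟨a, b, h⟩ := hS.exists_mul_mul_eq (x * y) x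
  have hx : (a : WithOne S) * x * (y * b) = x := by
    rw [← mul_assoc, mul_assoc (a : WithOne S)]
    exact congrArg _ h
  obtain ⟨n, hn⟩ := exists_mul_pow_succ_eq_of_mul_mul_eq hx
  refine ⟨b * (y * b) ^ n, ?_⟩
  rw [← mul_assoc, mul_assoc (x : WithOne S), mul_assoc, ← pow_succ', hn]

theorem exists_mul_mul_eq_right [Finite S] (hS : IsCompletelySimple S) (x y : S) :
    ∃ r : WithOne S, r * (y * x) = x := by
  obtain ⟨a, b, h⟩ := hS.exists_mul_mul_eq (y * x) x
  have hx : (a : WithOne S) * y * x * b = x := by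
    rw [mul_assoc (a : WithOne S)]
    exact congrArg _ h
  obtain ⟨n, hn⟩ := exists_pow_succ_mul_eq_of_mul_mul_eq hx
  refine ⟨(a * y) ^ n * a, ?_⟩
  rw [mul_assoc, ← mul_assoc (a : WithOne S), ← mul_assoc, ← pow_succ, hn]

theorem cutsBefore [Finite S] (hS : IsCompletelySimple S) {u v x y : S} (h : u * v = x * y) :
    CutsBefore ((u : WithOne S), (v : WithOne S)) (x, y) := by
  have h' : (u : WithOne S) * v = x * y := congrArg _ h
  obtain ⟨r, hr⟩ := hS.exists_mul_mul_eq_left x y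
  obtain ⟨l, hl⟩ := hS.exists_mul_mul_eq_right v u
  refine ⟨l * x, ?_, ?_⟩
  · calc (u : WithOne S) * (l * x) = u * (l * (u * v)) * r := by
          rw [h', mul_assoc (u : WithOne S), mul_assoc l, hr]
      _ = x := by rw [hl, h', hr]
  · rw [mul_assoc, ← h', hl]

end IsCompletelySimple

end FiniteSimple

namespace KarnofskyRhodes

variable {A S T : Type u} [Semigroup S] [Semigroup T] {φ : FreeSemigroup A →ₙ* S}

theorem val_nil (φ : FreeSemigroup A →ₙ* S) : val φ [] = 1 := rfl

theorem val_singleton (φ : FreeSemigroup A →ₙ* S) (a : A) :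
    val φ [a] = (φ (FreeSemigroup.of a) : WithOne S) := mul_one _

theorem val_cons (φ : FreeSemigroup A →ₙ* S) (a : A) (w : List A) :
    val φ (a :: w) = (φ (FreeSemigroup.of a) : WithOne S) * val φ w := List.prod_cons

theorem val_ne_one (φ : FreeSemigroup A →ₙ* S) {w : List A} (hw : w ≠ []) : val φ w ≠ 1 := by
  cases w with
  | nil => exact absurd rfl hw
  | cons a w => exact (val_letters φ ⟨a, w⟩).trans_ne WithOne.coe_ne_one

theorem val_surjective (hφ : Function.Surjective φ) : Function.Surjective (val φ) := by
  intro x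
  induction x with
  | one => exact ⟨[], val_nil φ⟩
  | coe x =>
    obtain ⟨w, rfl⟩ := hφ x
    exact ⟨letters w, val_letters φ w⟩

theorem val_comp (f : S →ₙ* T) (φ : FreeSemigroup A →ₙ* S) (w : List A) :
    val (f.comp φ) w = WithOne.mapMulHom f (val φ w) := by
  simp [val, map_list_prod, Function.comp_def]

section Reachability

theorem reachable_val (φ : FreeSemigroup A →ₙ* S) (w : List A) (s t : WithOne S) :
    Reachable φ (s, val φ w * t) (s * val φ w, t) := by
  induction w generalizing s with
  | nil =>
    rw [val_nil, one_mul, mul_one]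
    exact Relation.ReflTransGen.refl
  | cons a w ih =>
    rw [val_cons, ← mul_assoc]
    exact Relation.ReflTransGen.head ⟨a, rfl, mul_assoc _ _ _⟩ (ih _)

theorem IsEdge.cutsBefore {e : Triple A S} (h : IsEdge φ e) : CutsBefore e.1 e.2.2 :=
  ⟨_, h.1, h.2⟩

theorem reachable_iff_cutsBefore (hφ : Function.Surjective φ) {p q : Vertex S} :
    Reachable φ p q ↔ CutsBefore p q := by
  constructor
  · intro h
    induction h with
    | refl => exact CutsBefore.refl p
    | tail _ h ih =>
      obtain ⟨a, ha⟩ := h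
      exact ih.trans ha.cutsBefore
  · rintro ⟨x, h₁, h₂⟩
    obtain ⟨w, rfl⟩ := val_surjective hφ x
    simpa only [h₁, ← h₂] using reachable_val φ w p.1 q.2

theorem isTransitionEdge_iff (hφ : Function.Surjective φ) {e : Triple A S} :
    IsTransitionEdge φ e ↔ IsEdge φ e ∧ ¬ CutsBefore e.2.2 e.1 := by
  simp only [IsTransitionEdge, reachable_iff_cutsBefore hφ]
  exact and_congr_right fun h => not_congr (and_iff_right h.cutsBefore)

end Reachability

section Paths

theorem cutsBefore_val_append (φ : FreeSemigroup A →ₙ* S) (l₁ m l₂ : List A) :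
    CutsBefore (val φ l₁, val φ (m ++ l₂)) (val φ (l₁ ++ m), val φ l₂) :=
  ⟨val φ m, (val_append φ l₁ m).symm, val_append φ m l₂⟩

theorem cutsBefore_or_cutsBefore_of_append_eq (φ : FreeSemigroup A →ₙ* S) {l₁ l₂ m₁ m₂ : List A}
    (h : l₁ ++ l₂ = m₁ ++ m₂) :
    CutsBefore (val φ l₁, val φ l₂) (val φ m₁, val φ m₂) ∨
      CutsBefore (val φ m₁, val φ m₂) (val φ l₁, val φ l₂) := by
  rcases List.append_eq_append_iff.1 h with ⟨k, rfl, rfl⟩ | ⟨k, rfl, rfl⟩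
  · exact Or.inl (cutsBefore_val_append _ _ _ _)
  · exact Or.inr (cutsBefore_val_append _ _ _ _)

theorem one_cutsBefore_val {w : FreeSemigroup A} {l₁ l₂ : List A} (h : letters w = l₁ ++ l₂) :
    CutsBefore (1, (φ w : WithOne S)) (val φ l₁, val φ l₂) := by
  rw [← val_letters, h]
  exact cutsBefore_val_append φ [] l₁ l₂

theorem val_cutsBefore_one {w : FreeSemigroup A} {l₁ l₂ : List A} (h : letters w = l₁ ++ l₂) :
    CutsBefore (val φ l₁, val φ l₂) ((φ w : WithOne S), 1) := by
  rw [← val_letters, h]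
  simpa only [List.append_nil, val_nil] using cutsBefore_val_append φ l₁ l₂ []

theorem cutsBefore_one_or_exists_transitionEdge (hφ : Function.Surjective φ) {w : FreeSemigroup A}
    {l₁ l₂ : List A} (h : letters w = l₁ ++ l₂) :
    CutsBefore (val φ l₁, val φ l₂) (1, (φ w : WithOne S)) ∨
      ∃ e ∈ transitionEdges φ w, CutsBefore e.2.2 (val φ l₁, val φ l₂) ∧
        CutsBefore (val φ l₁, val φ l₂) e.2.2 := by
  induction l₁ using List.reverseRecOn generalizing l₂ with
  | nil =>
    rw [← val_letters, h]
    exact Or.inl (CutsBefore.refl _)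
  | append_singleton l₁ a ih =>
    have h' : letters w = l₁ ++ a :: l₂ := by rw [h, List.append_assoc, List.singleton_append]
    by_cases hback : CutsBefore (val φ (l₁ ++ [a]), val φ l₂) (val φ l₁, val φ (a :: l₂))
    · rcases ih h' with h₁ | ⟨e, he, h₁, h₂⟩
      · exact Or.inl (hback.trans h₁)
      · exact Or.inr ⟨e, he, h₁.trans (cutsBefore_val_append φ l₁ [a] l₂), hback.trans h₂⟩
    · have hpath :
          ((val φ l₁, val φ (a :: l₂)), a, (val φ (l₁ ++ [a]), val φ l₂)) ∈ pathEdges φ w :=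
        ⟨l₁, a, l₂, h', rfl⟩
      exact Or.inr ⟨_, ⟨hpath, (isTransitionEdge_iff hφ).2 ⟨isEdge_of_mem_pathEdges hpath, hback⟩⟩,
        CutsBefore.refl _, CutsBefore.refl _⟩

theorem cutsBefore_or_cutsBefore_of_congruence (hφ : Function.Surjective φ)
    {w w' : FreeSemigroup A} (hww' : congruence φ w w') {l₁ l₂ m₁ m₂ : List A}
    (hl : letters w = l₁ ++ l₂) (hm : letters w' = m₁ ++ m₂) :
    CutsBefore (val φ l₁, val φ l₂) (val φ m₁, val φ m₂) ∨
      CutsBefore (val φ m₁, val φ m₂) (val φ l₁, val φ l₂) := by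
  obtain ⟨hval, hedges⟩ := hww'
  rcases cutsBefore_one_or_exists_transitionEdge hφ hl with h | ⟨e, he, hel, hle⟩
  · rw [hval] at h
    exact Or.inl (h.trans (one_cutsBefore_val hm))
  · rw [hedges] at he
    obtain ⟨⟨k₁, a, k₂, hk, rfl⟩, -⟩ := he
    have hkm : (k₁ ++ [a]) ++ k₂ = m₁ ++ m₂ := by
      rw [← hm, hk, List.append_assoc, List.singleton_append]
    exact (cutsBefore_or_cutsBefore_of_append_eq φ hkm).imp hle.trans fun h => h.trans hel

end Paths

section Edges

/-- The edge of the two-sided Cayley graph of `φ` that is labeled `a` and goes from `(s, φ(a) t)` to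
`(s φ(a), t)`. Every edge has this form. -/
def edge (φ : FreeSemigroup A →ₙ* S) (s : WithOne S) (a : A) (t : WithOne S) : Triple A S :=
  ((s, φ (FreeSemigroup.of a) * t), a, (s * φ (FreeSemigroup.of a), t))

theorem mem_pathEdges_iff {w : FreeSemigroup A} {e : Triple A S} :
    e ∈ pathEdges φ w ↔
      ∃ l₁ a l₂, letters w = l₁ ++ a :: l₂ ∧ e = edge φ (val φ l₁) a (val φ l₂) := by
  simp only [pathEdges, edge, Set.mem_ofPred_eq, val_append, val_cons, val_nil, mul_one]

/-- Two edges of the two-sided Cayley graph are comparable if they coincide or one of them precedes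
the other on some path; precedence is expressed by `CutsBefore`, which for surjective `φ` is
reachability. -/
def EdgesComparable (e e' : Triple A S) : Prop :=
  e = e' ∨ CutsBefore e.2.2 e'.1 ∨ CutsBefore e'.2.2 e.1

theorem EdgesComparable.symm {e e' : Triple A S} (h : EdgesComparable e e') :
    EdgesComparable e' e :=
  h.imp Eq.symm Or.symm

theorem EdgesComparable.map (f : S →ₙ* T) {a b : A} {s t s' t' : WithOne S}
    (h : EdgesComparable (edge φ s a t) (edge φ s' b t')) :
    EdgesComparable
      (edge (f.comp φ) (WithOne.mapMulHom f s) a (WithOne.mapMulHom f t))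
      (edge (f.comp φ) (WithOne.mapMulHom f s') b (WithOne.mapMulHom f t')) := by
  rcases h with h | h | h
  · simp only [edge, Prod.mk.injEq] at h
    obtain ⟨⟨rfl, -⟩, rfl, -, rfl⟩ := h
    exact Or.inl rfl
  · exact Or.inr (Or.inl (by simpa [edge] using h.map (WithOne.mapMulHom f)))
  · exact Or.inr (Or.inr (by simpa [edge] using h.map (WithOne.mapMulHom f)))

end Edges

theorem exists_append_cons_and_not {α : Type*} (P : List α → List α → Prop) {l : List α}
    (hfirst : P [] l) (hlast : ¬ P l []) :
    ∃ l₁ b l₂, l = l₁ ++ b :: l₂ ∧ P l₁ (b :: l₂) ∧ ¬ P (l₁ ++ [b]) l₂ := by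
  induction l generalizing P with
  | nil => exact absurd hfirst hlast
  | cons b l ih =>
    by_cases hb : P [b] l
    · obtain ⟨l₁, c, l₂, rfl, h₁, h₂⟩ := ih (fun k m => P (b :: k) m) hb hlast
      exact ⟨b :: l₁, c, l₂, rfl, h₁, h₂⟩
    · exact ⟨[], b, l, rfl, hfirst, hb⟩

theorem exists_not_edgesComparable (hφ : Function.Surjective φ) {w w' : FreeSemigroup A}
    (hww' : φ w = φ w') (h : ¬ transitionEdges φ w ⊆ transitionEdges φ w') :
    ∃ l₁ a l₂ m₁ b m₂, letters w = l₁ ++ a :: l₂ ∧ letters w' = m₁ ++ b :: m₂ ∧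
      ¬ EdgesComparable (edge φ (val φ l₁) a (val φ l₂)) (edge φ (val φ m₁) b (val φ m₂)) := by
  obtain ⟨e, ⟨hew, htrans⟩, hew'⟩ := Set.not_subset.1 h
  have hback : ¬ CutsBefore e.2.2 e.1 := ((isTransitionEdge_iff hφ).1 htrans).2
  obtain ⟨l₁, a, l₂, hl, rfl⟩ := mem_pathEdges_iff.1 hew
  have hstart : CutsBefore (1, (φ w : WithOne S)) (edge φ (val φ l₁) a (val φ l₂)).1 := by
    simpa only [edge, val_cons] using one_cutsBefore_val (φ := φ) hl
  have hend : CutsBefore (edge φ (val φ l₁) a (val φ l₂)).2.2 ((φ w : WithOne S), 1) := by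
    have hl' : letters w = (l₁ ++ [a]) ++ l₂ := by rw [hl, List.append_assoc, List.singleton_append]
    simpa only [edge, val_append, val_singleton] using val_cutsBefore_one (φ := φ) hl'
  rw [hww', ← val_letters] at hstart hend
  -- The edge of `p_w'` at which the source of the transition edge of `p_w` ceases to be reachable.
  obtain ⟨m₁, b, m₂, hm, hsource, htarget⟩ := exists_append_cons_and_not
    (fun k m => CutsBefore (val φ k, val φ m) (edge φ (val φ l₁) a (val φ l₂)).1)
    hstart fun hlast => hback (hend.trans hlast)
  rw [val_cons] at hsource
  rw [val_append, val_singleton] at htarget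
  refine ⟨l₁, a, l₂, m₁, b, m₂, hl, hm, ?_⟩
  rintro (heq | hbefore | hafter)
  · exact hew' ⟨mem_pathEdges_iff.2 ⟨m₁, b, m₂, hm, heq⟩, htrans⟩
  · exact hback (hbefore.trans hsource)
  · exact htarget hafter

end KarnofskyRhodes

/-- The injective homomorphism from `M / ker ψ` induced by a homomorphism `ψ` of semigroups
(`Con.kerLift` is only available for monoids). -/
def kerMulLift {M N : Type*} [Mul M] [Mul N] (ψ : M →ₙ* N) : (Con.ker ψ).Quotient →ₙ* N where
  toFun x := Con.liftOn x ψ fun _ _ h => h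
  map_mul' := by
    rintro ⟨x⟩ ⟨y⟩
    exact map_mul ψ x y

theorem kerMulLift_injective {M N : Type*} [Mul M] [Mul N] (ψ : M →ₙ* N) :
    Function.Injective (kerMulLift ψ) := by
  rintro ⟨x⟩ ⟨y⟩ h
  exact (Con.eq _).2 h

namespace SemigroupPseudovariety

variable {V : SemigroupPseudovariety.{u}} {A : Type u}

theorem mem_of_injective {S T : Type u} [Semigroup S] [Semigroup T] [Nonempty S] (f : S →ₙ* T)
    (hf : Function.Injective f) (hT : V.Mem T) : V.Mem S := by
  have hrange : V.Mem f.srange := V.mem_subsemigroup T hT _ (Set.range_nonempty f)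
  let e : S ≃* f.srange := MulEquiv.ofBijective f.srangeRestrict
    ⟨fun x y h => hf (congrArg Subtype.val h), f.srangeRestrict_surjective⟩
  exact V.mem_image _ _ (e.symm : f.srange →ₙ* S) e.symm.surjective hrange

theorem mem_quotient_of_le {c d : Con (FreeSemigroup A)} (h : c ≤ d) (hc : V.Mem c.Quotient) :
    V.Mem d.Quotient :=
  V.mem_image _ _ (conProj h) (by rintro ⟨x⟩; exact ⟨c.mkMulHom x, rfl⟩) hc

section FreeIndex

instance : Preorder (V.FreeIndex A) :=
  inferInstanceAs (Preorder {c : Con (FreeSemigroup A) // V.Mem c.Quotient})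

instance (c : V.FreeIndex A) : Finite c.1.Quotient := V.finite_of_mem _ c.2

variable [Nonempty A] {T : Type u} [Semigroup T]

/-- The kernel of a homomorphism to a member of `V`, as an index of the inverse system that defines
the free pro-`V` semigroup. -/
def kerIndex (hT : V.Mem T) (ψ : FreeSemigroup A →ₙ* T) : V.FreeIndex A :=
  ⟨Con.ker ψ,
    have : Nonempty (Con.ker ψ).Quotient :=
      ⟨(Con.ker ψ).mkMulHom (FreeSemigroup.of (Classical.arbitrary A))⟩
    mem_of_injective (kerMulLift ψ) (kerMulLift_injective ψ) hT⟩

instance : Nonempty (V.FreeIndex A) :=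
  ⟨kerIndex V.mem_trivial ⟨fun _ => PUnit.unit, fun _ _ => rfl⟩⟩

instance : IsCodirectedOrder (V.FreeIndex A) where
  directed c d :=
    ⟨kerIndex (V.mem_prod _ _ c.2 d.2) (c.1.mkMulHom.prod d.1.mkMulHom),
      fun _ _ h => (Con.eq _).1 (congrArg Prod.fst h),
      fun _ _ h => (Con.eq _).1 (congrArg Prod.snd h)⟩

end FreeIndex

section Projections

/-- The projection of the free pro-`V` semigroup on one of its defining quotients, with identities
adjoined. -/
def projOne (c : V.FreeIndex A) : WithOne (V.freePro A) →* WithOne c.1.Quotient :=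
  WithOne.mapMulHom ((Pi.evalMulHom _ c).comp (MulMemClass.subtype (V.freePro A)))

theorem projOne_ext [Nonempty A] {x y : WithOne (V.freePro A)}
    (h : ∀ c : V.FreeIndex A, projOne c x = projOne c y) : x = y := by
  have c₀ : V.FreeIndex A := Classical.arbitrary _
  induction x with
  | one =>
    induction y with
    | one => rfl
    | coe y => exact absurd (h c₀).symm WithOne.coe_ne_one
  | coe x =>
    induction y with
    | one => exact absurd (h c₀) WithOne.coe_ne_one
    | coe y => exact WithOne.coe_inj.2 (Subtype.ext (funext fun c => WithOne.coe_inj.1 (h c)))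

theorem mapMulHom_conProj_projOne {c d : V.FreeIndex A} (h : c.1 ≤ d.1)
    (x : WithOne (V.freePro A)) :
    WithOne.mapMulHom (conProj h) (projOne c x) = projOne d x := by
  induction x with
  | one => rfl
  | coe x => exact congrArg _ (x.2 c d h)

theorem mapMulHom_conProj_val {c d : V.FreeIndex A} (h : c.1 ≤ d.1) (w : List A) :
    WithOne.mapMulHom (conProj h) (val c.1.mkMulHom w) = val d.1.mkMulHom w :=
  (val_comp (conProj h) c.1.mkMulHom w).symm

variable (V A) in
/-- The canonical homomorphism from the free semigroup to the free pro-`V` semigroup. -/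
def wordHom : FreeSemigroup A →ₙ* V.freePro A where
  toFun w := ⟨fun c => c.1.mkMulHom w, fun _ _ _ => rfl⟩
  map_mul' _ _ := rfl

theorem projOne_val_wordHom (c : V.FreeIndex A) (w : List A) :
    projOne c (val (V.wordHom A) w) = val c.1.mkMulHom w :=
  (val_comp _ (V.wordHom A) w).symm

/-- The continuous extension to the free pro-`V` semigroup of a homomorphism from the free semigroup
to a member of `V`. -/
def extend [Nonempty A] {T : Type u} [Semigroup T] (hT : V.Mem T) (ψ : FreeSemigroup A →ₙ* T) :
    V.freePro A →ₙ* T :=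
  (kerMulLift ψ).comp ((Pi.evalMulHom _ (kerIndex hT ψ)).comp (MulMemClass.subtype (V.freePro A)))

end Projections

section Limits

variable [Nonempty A]

variable (V A) in
/-- An ultrafilter of indices that contains all sets `{c | c ≤ d}`. Limits along it replace the
topology of the free pro-`V` semigroup. -/
noncomputable def indexUltrafilter : Ultrafilter (V.FreeIndex A) := Ultrafilter.of atBot

theorem eventually_le (d : V.FreeIndex A) :
    ∀ᶠ c : V.FreeIndex A in indexUltrafilter V A, c.1 ≤ d.1 :=
  Ultrafilter.of_le _ (eventually_le_atBot d)

/-- The family of words `w` converges along `indexUltrafilter` to the element `x` of the free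
pro-`V` semigroup with an identity adjoined, which stands for the empty word. -/
def IsLim (w : V.FreeIndex A → List A) (x : WithOne (V.freePro A)) : Prop :=
  ∀ d : V.FreeIndex A, ∀ᶠ c in indexUltrafilter V A, val d.1.mkMulHom (w c) = projOne d x

theorem exists_isLim (w : V.FreeIndex A → List A) : ∃ x, IsLim w x := by
  by_cases hnil : ∀ᶠ c in indexUltrafilter V A, w c = []
  · exact ⟨1, fun d => hnil.mono fun c hc => by rw [hc, val_nil, map_one]⟩
  have hval (d : V.FreeIndex A) : ∃ y : d.1.Quotient,
      ∀ᶠ c in indexUltrafilter V A, val d.1.mkMulHom (w c) = y := by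
    refine Ultrafilter.eventually_exists_iff.1
      ((Ultrafilter.eventually_not.2 hnil).mono fun c hc => ?_)
    obtain ⟨y, hy⟩ := WithOne.ne_one_iff_exists.1 (val_ne_one d.1.mkMulHom hc)
    exact ⟨y, hy.symm⟩
  choose y hy using hval
  have hcompat : y ∈ V.freePro A := by
    intro c d h
    obtain ⟨e, hec, hed⟩ := ((hy c).and (hy d)).exists
    rw [← WithOne.coe_inj, ← WithOne.mapMulHom_coe, ← hec, ← hed, mapMulHom_conProj_val]
  exact ⟨((⟨y, hcompat⟩ : V.freePro A) : WithOne (V.freePro A)), hy⟩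

namespace IsLim

variable {v w : V.FreeIndex A → List A} {x y : WithOne (V.freePro A)}

theorem unique (hx : IsLim w x) (hy : IsLim w y) : x = y := by
  refine projOne_ext fun d => ?_
  obtain ⟨c, hcx, hcy⟩ := ((hx d).and (hy d)).exists
  exact hcx.symm.trans hcy

theorem append (hv : IsLim v x) (hw : IsLim w y) : IsLim (fun c => v c ++ w c) (x * y) :=
  fun d => ((hv d).and (hw d)).mono fun c hc => by rw [val_append, hc.1, hc.2, map_mul]

theorem of_eventually_eq {l : List A} (h : ∀ᶠ c in indexUltrafilter V A, w c = l) :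
    IsLim w (val (V.wordHom A) l) :=
  fun d => h.mono fun c hc => by rw [projOne_val_wordHom, hc]

theorem congr (hv : IsLim v x)
    (hvw : ∀ c : V.FreeIndex A, val c.1.mkMulHom (v c) = val c.1.mkMulHom (w c)) : IsLim w x := by
  intro d
  filter_upwards [hv d, eventually_le d] with c hc hcd
  rw [← hc, ← mapMulHom_conProj_val hcd, ← hvw, mapMulHom_conProj_val]

theorem eventually_val_eq {T : Type u} [Semigroup T] (hT : V.Mem T) (ψ : FreeSemigroup A →ₙ* T)
    (hw : IsLim w x) :
    ∀ᶠ c in indexUltrafilter V A, val ψ (w c) = WithOne.mapMulHom (extend hT ψ) x := by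
  filter_upwards [hw (kerIndex hT ψ)] with c hc
  calc val ψ (w c) = WithOne.mapMulHom (kerMulLift ψ) (val (Con.ker ψ).mkMulHom (w c)) :=
        val_comp (kerMulLift ψ) (Con.ker ψ).mkMulHom (w c)
    _ = WithOne.mapMulHom (kerMulLift ψ) (projOne (kerIndex hT ψ) x) := congrArg _ hc
    _ = WithOne.mapMulHom (extend hT ψ) x := WithOne.mapMulHom_mapMulHom _ _ _

end IsLim

theorem cutsBefore_of_eventually {p q : WithOne (V.freePro A) × WithOne (V.freePro A)}
    (h : ∀ᶠ c in indexUltrafilter V A,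
      CutsBefore (Prod.map (projOne c) (projOne c) p) (Prod.map (projOne c) (projOne c) q)) :
    CutsBefore p q := by
  have hwords : ∀ᶠ c in indexUltrafilter V A, ∃ w : List A,
      projOne c p.1 * val c.1.mkMulHom w = projOne c q.1 ∧
        projOne c p.2 = val c.1.mkMulHom w * projOne c q.2 := by
    filter_upwards [h] with c hc
    obtain ⟨t, ht⟩ := hc
    obtain ⟨w, rfl⟩ := val_surjective (φ := c.1.mkMulHom) Quotient.mk''_surjective t
    exact ⟨w, ht⟩
  obtain ⟨w, hw⟩ := hwords.choice
  obtain ⟨t, ht⟩ := exists_isLim w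
  have hproj (d : V.FreeIndex A) :
      projOne d p.1 * projOne d t = projOne d q.1 ∧
        projOne d p.2 = projOne d t * projOne d q.2 := by
    obtain ⟨c, ⟨h₁, h₂⟩, hct, hcd⟩ := (hw.and ((ht d).and (eventually_le d))).exists
    have h₁' := congrArg (WithOne.mapMulHom (conProj hcd)) h₁
    have h₂' := congrArg (WithOne.mapMulHom (conProj hcd)) h₂
    simp only [map_mul, mapMulHom_conProj_projOne, mapMulHom_conProj_val, hct] at h₁' h₂'
    exact ⟨h₁', h₂'⟩
  exact ⟨t, projOne_ext fun d => by rw [map_mul, (hproj d).1],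
    projOne_ext fun d => by rw [map_mul, (hproj d).2]⟩

theorem isEquidivisible_freePro_of_quotients
    (h : ∀ u v x y : V.freePro A, u * v = x * y → ∀ c : V.FreeIndex A,
      CutsBefore ((u.1 c : WithOne c.1.Quotient), (v.1 c : WithOne c.1.Quotient)) (x.1 c, y.1 c) ∨
        CutsBefore ((x.1 c : WithOne c.1.Quotient), (y.1 c : WithOne c.1.Quotient))
          (u.1 c, v.1 c)) :
    IsEquidivisible (V.freePro A) := by
  refine isEquidivisible_of_cutsBefore_or_cutsBefore fun u v x y huv => ?_
  have hor := Eventually.of_forall (f := (indexUltrafilter V A : Filter _)) (h u v x y huv)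
  exact (Ultrafilter.eventually_or.1 hor).imp cutsBefore_of_eventually cutsBefore_of_eventually

end Limits

theorem ContainedInCS.equidivisible (hV : V.ContainedInCS) : V.Equidivisible :=
  fun _ _ _ => isEquidivisible_freePro_of_quotients fun _ _ _ _ huv c =>
    Or.inl ((hV _ c.2).cutsBefore (congrFun (congrArg Subtype.val huv) c))

theorem ClosedUnderKR.equidivisible (hV : V.ClosedUnderKR) : V.Equidivisible := by
  intro A _ _
  refine isEquidivisible_freePro_of_quotients fun u v x y huv c => ?_
  let φ := c.1.mkMulHom
  have hφ : Function.Surjective φ := Quotient.mk''_surjective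
  let d : V.FreeIndex A := ⟨congruence φ, hV A _ φ hφ c.2⟩
  have hdc : d ≤ c := fun _ _ h => (Con.eq c.1).1 h.1
  have hword (z : V.freePro A) : ∃ w, d.1.mkMulHom w = z.1 d ∧ φ w = z.1 c := by
    obtain ⟨w, hw⟩ : ∃ w, d.1.mkMulHom w = z.1 d := Quotient.mk''_surjective (z.1 d)
    exact ⟨w, hw, by rw [← z.2 d c hdc, ← hw]; rfl⟩
  obtain ⟨u', hud, huc⟩ := hword u
  obtain ⟨v', hvd, hvc⟩ := hword v
  obtain ⟨x', hxd, hxc⟩ := hword x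
  obtain ⟨y', hyd, hyc⟩ := hword y
  have hcong : congruence φ (u' * v') (x' * y') := by
    refine (Con.eq d.1).1 (show d.1.mkMulHom _ = d.1.mkMulHom _ from ?_)
    rw [map_mul, map_mul, hud, hvd, hxd, hyd]
    exact congrFun (congrArg Subtype.val huv) d
  simpa only [val_letters, huc, hvc, hxc, hyc] using
    cutsBefore_or_cutsBefore_of_congruence hφ hcong (letters_mul u' v') (letters_mul x' y')

section Letters

variable (V) in
/-- The image of a letter in the free pro-`V` semigroup with an identity adjoined. -/
def letter (a : A) : WithOne (V.freePro A) :=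
  (V.wordHom A (FreeSemigroup.of a) : WithOne (V.freePro A))

theorem letter_ne_one (a : A) : V.letter a ≠ 1 := WithOne.coe_ne_one

theorem mapMulHom_extend_letter [Nonempty A] {T : Type u} [Semigroup T] (hT : V.Mem T) (g : A → T)
    (a : A) : WithOne.mapMulHom (extend hT (FreeSemigroup.lift g)) (V.letter a) = g a := rfl

/-- Some member of `V` has an element that is not a product. For an equidivisible `V`, this property
decides which of the two alternatives holds. -/
def HasIndecomposable (V : SemigroupPseudovariety.{u}) : Prop :=
  ∃ (N : Type u) (_ : Semigroup N), V.Mem N ∧ ∃ n : N, ∀ x y : N, x * y ≠ n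

namespace HasIndecomposable

variable [Nonempty A]

theorem eq_one_or_eq_one_of_mul_eq_letter (hV : V.HasIndecomposable) {a : A}
    {x y : WithOne (V.freePro A)} (h : x * y = V.letter a) : x = 1 ∨ y = 1 := by
  obtain ⟨N, _, hN, n, hn⟩ := hV
  induction x with
  | one => exact Or.inl rfl
  | coe x =>
  induction y with
  | one => exact Or.inr rfl
  | coe y =>
  have himage := congrArg (WithOne.mapMulHom (extend hN (FreeSemigroup.lift fun _ => n))) h
  rw [mapMulHom_extend_letter, ← WithOne.coe_mul, WithOne.mapMulHom_coe, map_mul] at himage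
  exact absurd (WithOne.coe_inj.1 himage) (hn _ _)

theorem letter_injective (hV : V.HasIndecomposable) :
    Function.Injective (V.letter (A := A)) := by
  classical
  obtain ⟨N, _, hN, n, hn⟩ := hV
  intro a b h
  by_contra hab
  have himage := congrArg
    (WithOne.mapMulHom (extend hN (FreeSemigroup.lift fun z => if z = a then n else n * n))) h
  rw [mapMulHom_extend_letter, mapMulHom_extend_letter, if_pos rfl, if_neg (Ne.symm hab)] at himage
  exact hn n n (WithOne.coe_inj.1 himage).symm

variable {a b : A} {x y t : WithOne (V.freePro A)}

theorem eq_one_or_exists_of_letter_mul_eq (hV : V.HasIndecomposable)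
    (hF : IsEquidivisible (V.freePro A)) (h : V.letter a * x = t * y) :
    t = 1 ∨ ∃ s, t = V.letter a * s ∧ x = s * y := by
  rcases hF.cutsBefore_or_cutsBefore (p := (V.letter a, x)) (q := (t, y)) h with
    ⟨s, h₁, h₂⟩ | ⟨s, h₁, h₂⟩
  · exact Or.inr ⟨s, h₁.symm, h₂⟩
  · dsimp only at h₁ h₂
    rcases hV.eq_one_or_eq_one_of_mul_eq_letter h₁ with ht | rfl
    · exact Or.inl ht
    · exact Or.inr ⟨1, by rw [mul_one, ← h₁, mul_one], by rw [h₂, one_mul, one_mul]⟩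

theorem eq_and_eq_of_letter_mul_eq (hV : V.HasIndecomposable) (hF : IsEquidivisible (V.freePro A))
    (h : V.letter a * x = V.letter b * y) : a = b ∧ x = y := by
  rcases hV.eq_one_or_exists_of_letter_mul_eq hF h with hb | ⟨s, hs, rfl⟩
  · exact absurd hb (letter_ne_one b)
  · obtain rfl := (hV.eq_one_or_eq_one_of_mul_eq_letter hs.symm).resolve_left (letter_ne_one a)
    exact ⟨hV.letter_injective (by rw [hs, mul_one]), one_mul y⟩

variable {s' t' s : WithOne (V.freePro A)}

theorem edgesComparable_of_cutsBefore (hV : V.HasIndecomposable)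
    (hF : IsEquidivisible (V.freePro A))
    (h : CutsBefore (s, V.letter a * t) (s', V.letter b * t')) :
    EdgesComparable (edge (V.wordHom A) s a t) (edge (V.wordHom A) s' b t') := by
  obtain ⟨x, hs, hx⟩ := h
  dsimp only at hs hx
  subst hs
  rcases hV.eq_one_or_exists_of_letter_mul_eq hF hx with rfl | ⟨y, rfl, rfl⟩
  · obtain ⟨rfl, rfl⟩ := hV.eq_and_eq_of_letter_mul_eq hF (hx.trans (one_mul _))
    exact Or.inl (by rw [mul_one])
  · exact Or.inr (Or.inl ⟨y, mul_assoc _ _ _, rfl⟩)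

theorem edgesComparable (hV : V.HasIndecomposable) (hF : IsEquidivisible (V.freePro A))
    (h : s * (V.letter a * t) = s' * (V.letter b * t')) :
    EdgesComparable (edge (V.wordHom A) s a t) (edge (V.wordHom A) s' b t') :=
  (hF.cutsBefore_or_cutsBefore (p := (s, V.letter a * t)) (q := (s', V.letter b * t')) h).elim
    (hV.edgesComparable_of_cutsBefore hF) fun h => (hV.edgesComparable_of_cutsBefore hF h).symm

end HasIndecomposable

end Letters

section Expansion

variable [Nonempty A]

theorem exists_isLim_append_cons [Finite A] (l₁ : V.FreeIndex A → List A) (a : V.FreeIndex A → A)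
    (l₂ : V.FreeIndex A → List A) :
    ∃ x₁ a₀ x₂, IsLim (fun c => l₁ c ++ a c :: l₂ c) (x₁ * (V.letter a₀ * x₂)) ∧
      ∀ (S : Type u) [Semigroup S] (hS : V.Mem S) (φ : FreeSemigroup A →ₙ* S),
        ∀ᶠ c in indexUltrafilter V A, edge φ (val φ (l₁ c)) (a c) (val φ (l₂ c)) =
          edge φ (WithOne.mapMulHom (extend hS φ) x₁) a₀ (WithOne.mapMulHom (extend hS φ) x₂) := by
  obtain ⟨x₁, hx₁⟩ := exists_isLim l₁
  obtain ⟨x₂, hx₂⟩ := exists_isLim l₂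
  obtain ⟨a₀, ha⟩ : ∃ a₀, ∀ᶠ c in indexUltrafilter V A, a c = a₀ :=
    Ultrafilter.eventually_exists_iff.1 (Eventually.of_forall fun c => ⟨a c, rfl⟩)
  have hletter : IsLim (fun c => [a c]) (V.letter a₀) := by
    rw [letter, ← val_singleton]
    exact IsLim.of_eventually_eq (ha.mono fun c hc => by rw [hc])
  refine ⟨x₁, a₀, x₂, hx₁.append (hletter.append hx₂), fun S _ hS φ => ?_⟩
  filter_upwards [hx₁.eventually_val_eq hS φ, ha, hx₂.eventually_val_eq hS φ] with c h₁ hc h₂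
  rw [h₁, hc, h₂]

theorem exists_rel_and_not_transitionEdges_subset {S : Type u} [Semigroup S] (hS : V.Mem S)
    {φ : FreeSemigroup A →ₙ* S} (hexp : ¬ V.Mem (Expansion φ)) (c : V.FreeIndex A) :
    ∃ w w', c.1 w w' ∧ φ w = φ w' ∧ ¬ transitionEdges φ w ⊆ transitionEdges φ w' := by
  obtain ⟨d, hdc, hdφ⟩ := exists_le_le c (kerIndex hS φ)
  by_contra! hsub
  refine hexp (mem_quotient_of_le (fun w w' h => ?_) d.2)
  have hφ : φ w = φ w' := hdφ h
  exact ⟨hφ, (hsub w w' (hdc h) hφ).antisymm (hsub w' w (c.1.symm (hdc h)) hφ.symm)⟩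

end Expansion

theorem Equidivisible.closedUnderKR (hE : V.Equidivisible) (hV : V.HasIndecomposable) :
    V.ClosedUnderKR := by
  intro A S _ _ φ hφ hS
  obtain ⟨s⟩ := V.nonempty_of_mem S hS
  have : Nonempty A := ⟨(hφ s).choose.head⟩
  by_contra hexp
  choose w w' hww' hval hedges using exists_rel_and_not_transitionEdges_subset hS hexp
  choose l₁ a l₂ m₁ b m₂ hw hw' hincomp using
    fun c => exists_not_edgesComparable hφ (hval c) (hedges c)
  obtain ⟨x₁, a₀, x₂, hx, hxφ⟩ := exists_isLim_append_cons l₁ a l₂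
  obtain ⟨y₁, b₀, y₂, hy, hyφ⟩ := exists_isLim_append_cons m₁ b m₂
  have hlim : x₁ * (V.letter a₀ * x₂) = y₁ * (V.letter b₀ * y₂) := by
    refine (hx.congr fun c => ?_).unique hy
    rw [← hw, ← hw', val_letters, val_letters]
    exact congrArg _ ((Con.eq c.1).2 (hww' c))
  obtain ⟨c, hcx, hcy⟩ := ((hxφ S hS φ).and (hyφ S hS φ)).exists
  refine hincomp c ?_
  rw [hcx, hcy]
  exact (hV.edgesComparable (hE A) hlim).map (extend hS φ)

section Zero

/-- Some member of `V` has a zero and another element. Only pseudovarieties contained in `CS`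
fail to have this property. -/
def HasNontrivialZero (V : SemigroupPseudovariety.{u}) : Prop :=
  ∃ (T : Type u) (_ : Semigroup T), V.Mem T ∧ ∃ e z : T, e ≠ z ∧ ∀ x : T, x * z = z ∧ z * x = z

/-- The Rees congruence of a two-sided ideal `J`, which collapses `J` to a point. -/
def reesCon {S : Type*} [Semigroup S] (J : Set S)
    (hJ : ∀ s : S, ∀ x ∈ J, s * x ∈ J ∧ x * s ∈ J) : Con S where
  r x y := x = y ∨ (x ∈ J ∧ y ∈ J)
  iseqv := ⟨fun _ => Or.inl rfl, fun h => h.imp Eq.symm And.symm, by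
    rintro x y z (rfl | ⟨hx, hy⟩) (rfl | ⟨hy', hz⟩)
    exacts [Or.inl rfl, Or.inr ⟨hy', hz⟩, Or.inr ⟨hx, hy⟩, Or.inr ⟨hx, hz⟩]⟩
  mul' := by
    rintro w x y z (rfl | ⟨hw, hx⟩) (rfl | ⟨hy, hz⟩)
    exacts [Or.inl rfl, Or.inr ⟨(hJ _ _ hy).1, (hJ _ _ hz).1⟩,
      Or.inr ⟨(hJ _ _ hw).2, (hJ _ _ hx).2⟩, Or.inr ⟨(hJ _ _ hw).2, (hJ _ _ hx).2⟩]

variable {T : Type u} [Semigroup T]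

theorem hasNontrivialZero_of_ideal (hT : V.Mem T) {J : Set T} (hJ : J.Nonempty)
    (hideal : ∀ s : T, ∀ x ∈ J, s * x ∈ J ∧ x * s ∈ J) (hproper : J ≠ Set.univ) :
    V.HasNontrivialZero := by
  obtain ⟨j, hj⟩ := hJ
  obtain ⟨s, hs⟩ := (Set.ne_univ_iff_exists_notMem J).1 hproper
  let π := (reesCon J hideal).mkMulHom
  refine ⟨_, inferInstance, V.mem_image _ _ π Quotient.mk''_surjective hT, π s, π j, ?_, ?_⟩
  · intro h
    rcases (Con.eq _).1 h with rfl | h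
    exacts [hs hj, hs h.1]
  · rintro ⟨x⟩
    exact ⟨(Con.eq _).2 (Or.inr ⟨(hideal x j hj).1, hj⟩),
      (Con.eq _).2 (Or.inr ⟨(hideal x j hj).2, hj⟩)⟩

theorem hasNontrivialZero_of_idempotents (hT : V.Mem T) {e f : T} (he : e * e = e) (hf : f * f = f)
    (hef : e * f = f) (hfe : f * e = f) (hne : e ≠ f) : V.HasNontrivialZero := by
  let P : Subsemigroup T :=
    { carrier := {e, f}
      mul_mem' := by
        rintro x y (rfl | rfl) (rfl | rfl)
        exacts [Or.inl he, Or.inr hef, Or.inr hfe, Or.inr hf] }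
  refine ⟨P, inferInstance, V.mem_subsemigroup T hT P ⟨e, Or.inl rfl⟩, ⟨e, Or.inl rfl⟩,
    ⟨f, Or.inr rfl⟩, fun h => hne (congrArg Subtype.val h), ?_⟩
  rintro ⟨x, rfl | rfl⟩
  exacts [⟨Subtype.ext hef, Subtype.ext hfe⟩, ⟨Subtype.ext hf, Subtype.ext hf⟩]

theorem exists_mul_self_eq_of_finite (S : Type*) [Semigroup S] [Finite S] [Nonempty S] :
    ∃ e : S, e * e = e := by
  let _ : TopologicalSpace S := ⊥
  have : DiscreteTopology S := ⟨rfl⟩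
  exact exists_idempotent_of_compact_t2_of_continuous_mul_left fun _ =>
    continuous_of_discreteTopology

theorem hasNontrivialZero_of_not_containedInCS (hV : ¬ V.ContainedInCS) :
    V.HasNontrivialZero := by
  simp only [ContainedInCS, not_forall] at hV
  obtain ⟨T, _, hT, hCS⟩ := hV
  rcases not_and_or.1 hCS with hsimple | hprimitive
  · push Not at hsimple
    obtain ⟨J, hJ, hideal, hproper⟩ := hsimple
    exact hasNontrivialZero_of_ideal hT hJ hideal hproper
  · have := V.finite_of_mem T hT
    have := V.nonempty_of_mem T hT
    obtain ⟨e, he⟩ := exists_mul_self_eq_of_finite T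
    push Not at hprimitive
    obtain ⟨f, hf, hef, hfe, hne⟩ := hprimitive e he
    exact hasNontrivialZero_of_idempotents hT he hf hef hfe hne.symm

theorem HasNontrivialZero.letter_ne_mul_letter_mul [Nonempty A] (hV : V.HasNontrivialZero)
    {a b : A} (hab : a ≠ b) (x y : WithOne (V.freePro A)) : V.letter a ≠ x * V.letter b * y := by
  classical
  obtain ⟨T, _, hT, e, z, hez, hz⟩ := hV
  have mul_z (s : WithOne T) : s * z = z := by
    induction s with
    | one => exact one_mul _
    | coe s => exact congrArg _ (hz s).1
  have z_mul (s : WithOne T) : z * s = z := by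
    induction s with
    | one => exact mul_one _
    | coe s => exact congrArg _ (hz s).2
  intro h
  have himage := congrArg
    (WithOne.mapMulHom (extend hT (FreeSemigroup.lift fun c => if c = b then z else e))) h
  rw [map_mul, map_mul, mapMulHom_extend_letter, mapMulHom_extend_letter, if_neg hab, if_pos rfl,
    mul_z, z_mul] at himage
  exact hez (WithOne.coe_inj.1 himage)

end Zero

section CompletelyRegular

variable {T : Type u} [Semigroup T]

theorem exists_pow_add_two_eq (hI : ¬ V.HasIndecomposable) (hT : V.Mem T) (s : T) :
    ∃ n : ℕ, (s : WithOne T) ^ (n + 2) = s := by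
  let P : Subsemigroup T :=
    { carrier := {x | ∃ n : ℕ, (s : WithOne T) ^ (n + 1) = x}
      mul_mem' := by
        rintro x y ⟨m, hm⟩ ⟨n, hn⟩
        exact ⟨m + 1 + n, by rw [add_assoc, pow_add, hm, hn, WithOne.coe_mul]⟩ }
  have hs : s ∈ P := ⟨0, by rw [zero_add, pow_one]⟩
  have hP : V.Mem P := V.mem_subsemigroup T hT P ⟨s, hs⟩
  obtain ⟨⟨x, m, hm⟩, ⟨y, n, hn⟩, hxy⟩ : ∃ x y : P, x * y = ⟨s, hs⟩ := by
    by_contra! hne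
    exact hI ⟨P, inferInstance, hP, ⟨s, hs⟩, hne⟩
  have hxy' : x * y = s := congrArg Subtype.val hxy
  refine ⟨m + n, ?_⟩
  calc (s : WithOne T) ^ (m + n + 2) = s ^ (m + 1) * s ^ (n + 1) := by
        rw [← pow_add, add_add_add_comm]
    _ = s := by rw [hm, hn, ← WithOne.coe_mul, hxy']

theorem cutsBefore_mul_self (hI : ¬ V.HasIndecomposable) [Nonempty A] (x : V.freePro A) :
    CutsBefore ((x * x : WithOne (V.freePro A)), (x : WithOne (V.freePro A))) (x, x * x) := by
  refine cutsBefore_of_eventually (Eventually.of_forall fun c => ?_)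
  obtain ⟨n, hn⟩ := exists_pow_add_two_eq hI c.2 (x.1 c)
  have hleft : (x.1 c : WithOne c.1.Quotient) * x.1 c * x.1 c ^ n = x.1 c := by
    rw [← pow_two, ← pow_add, add_comm, hn]
  have hright : (x.1 c : WithOne c.1.Quotient) ^ n * (x.1 c * x.1 c) = x.1 c := by
    rw [← pow_two, ← pow_add, hn]
  exact ⟨_, hleft, hright.symm⟩

theorem Equidivisible.containedInCS (hE : V.Equidivisible) (hI : ¬ V.HasIndecomposable) :
    V.ContainedInCS := by
  by_contra hCS
  have hzero := hasNontrivialZero_of_not_containedInCS hCS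
  let a : ULift.{u} Bool := ⟨true⟩
  let b : ULift.{u} Bool := ⟨false⟩
  let p := V.letter a * V.letter b
  have hab : a ≠ b := fun h => Bool.noConfusion (congrArg ULift.down h)
  obtain ⟨z, hz, -⟩ : CutsBefore (p * p, p) (p, p * p) :=
    cutsBefore_mul_self hI (V.wordHom _ (FreeSemigroup.of a * FreeSemigroup.of b))
  rw [mul_assoc] at hz
  rcases (hE _).cutsBefore_or_cutsBefore (p := (V.letter a, V.letter b)) (q := (p, p * z)) hz.symm
    with ⟨t, -, hb⟩ | ⟨t, ha, -⟩
  · exact hzero.letter_ne_mul_letter_mul hab.symm t (V.letter b * z)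
      (hb.trans (by simp only [p, mul_assoc]))
  · exact hzero.letter_ne_mul_letter_mul hab (V.letter a) t ha.symm

end CompletelyRegular

end SemigroupPseudovariety

theorem theoremt (V : SemigroupPseudovariety.{u}) :
    V.Equidivisible ↔ V.ContainedInCS ∨ V.ClosedUnderKR := by
  constructor
  · intro hE
    by_cases hI : V.HasIndecomposable
    · exact Or.inr (hE.closedUnderKR hI)
    · exact Or.inl (hE.containedInCS hI)
  · rintro (hCS | hKR)
    · exact hCS.equidivisible
    · exact hKR.equidivisible
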